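/- **Model.** Time is discrete and there are $k\ge 1$ underlay blockchains, each of which exposes only its finalized, certified ledger, a finite sequence of entries. An entry is a user transaction or a cross-chain message; a message is either arbitrary data or a snapshot of another (or the same) chain's ledger with its certificate, and it carries a time $\tau$ before which no ledger may record it. Certificates are unforgeable: a certified ledger contains a snapshot only of a ledger for which a certificate exists. Every underlay has at least one honest validator. Honest validators read all underlay ledgers, receive the transactions of the environment, know the current time and may write entries to every underlay; they can write only transactions they have seen or received, snapshots of ledgers they hold, and data, with messages locked to the time of writing. The network is synchronous with delay bound $\Delta$: an entry written at time $t$ has reached all honest validators of its target chain by a time $a\in[t,t+\Delta]$ (chosen by the adversary). Clients are passive; each goes online at some time and from then on reads all underlay ledgers. An *overlay protocol* consists of a rule for what honest validators write (a function of what they have observed) and a rule by which a client computes its overlay ledger, a finite sequence of transactions, at time $t$ from $t$ and the underlay ledgers it has read since it went online; the overlay ledger contains only transactions that occur in ledgers the client holds. Everything else is adversarial. An underlay is *safe* if all ledgers of it that are ever certified (in particular those in the views of all clients and honest validators) are pairwise consistent (one is a prefix of the other) and every reader's view of it only gets extended over time. It is *live* (with a given latency $T\geq 1$) if every entry input to all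 its honest validators at time $a$ is in its ledger in the view of every online reader at every time $t'\ge a+T$. The overlay is *safe* if the overlay ledgers output by any two online clients at any two times are consistent and every client's overlay ledger only gets extended. It is *live with constant latency* if there is a $T'$, which does not depend on the execution, such that every transaction input at time $t$ to all honest validators is in the overlay ledger output at every time $t'\ge t+T'$ by every client that has been online for at least $T'$ at time $t'$. **Theorem.** Let there be at least two possible transactions, and let $k\ge 1$, $\Delta\ge0$, $T\ge 1$ and $l,s,b$ be integers. Consider the following property. (*) There is an overlay protocol over $k$ underlay chains such that in every execution (under synchrony with delay bound $\Delta$): a. if at least $s$ underlays are safe, or at least $b$ underlays are both safe and live with latency $T$, then the overlay is safe; b. if at least $l$ underlays are live with latency $T$, then the overlay is live with constant latency. If $\lfloor k/2\rfloor+1\le l\le k$, $s\ge 2(k-l)+1$ and $b\ge k-l+1$, then (*) holds. Moreover, if $l\le k$ and $s\le k$, then (*) holds if and only if $\lfloor k/2\rfloor+1\le l\le k$, $s\ge 2(k-l)+1$ and $b\ge k-l+1$. -/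

import Mathlib

/-!
# Overlay blockchains built on `k` underlay blockchains, in a synchronous network

Time is discrete (`ℕ`).  The underlay chains are black boxes that expose only their finalized,
certified ledgers for reading and writing.  An overlay protocol prescribes what the honest
validators write to the underlay ledgers and how a client computes the overlay ledger from the
underlay ledgers that it has read.
-/

namespace Interchain

/-- What may be recorded on an underlay ledger: a user transaction, or a cross-chain protocol
message, which is time-locked (`τ` is the earliest time at which it may be recorded) and is either
arbitrary data or a snapshot of the ledger `L` of the chain `j` with a certificate of its finality. -/
inductive Entry (k : ℕ) (Tx : Type) : Type
  | tx (x : Tx) : Entry k Tx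
  | note (τ : ℕ) (data : ℕ) : Entry k Tx
  | snap (τ : ℕ) (j : Fin k) (L : List (Entry k Tx)) : Entry k Tx

/-- The ledger of an underlay chain. -/
abbrev Ledger (k : ℕ) (Tx : Type) : Type := List (Entry k Tx)

/-- A reader's view at one time: a ledger for each underlay chain. -/
abbrev View (k : ℕ) (Tx : Type) : Type := Fin k → Ledger k Tx

/-- The entry may be recorded at time `t`, as far as its time lock is concerned. -/
def Entry.DueBy {k : ℕ} {Tx : Type} (t : ℕ) : Entry k Tx → Prop
  | .tx _ => True
  | .note τ _ => τ ≤ t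
  | .snap τ _ _ => τ ≤ t

/-- `Holds h j L`: whoever has had the views `h` holds a certificate for the ledger `L` of chain
`j`, having read `L` directly or as a snapshot inside another ledger that it holds. -/
inductive Holds {k : ℕ} {Tx : Type} (h : List (View k Tx)) : Fin k → Ledger k Tx → Prop
  | read {w : View k Tx} (hw : w ∈ h) (j : Fin k) : Holds h j (w j)
  | nested {i j : Fin k} {L L' : Ledger k Tx} {τ : ℕ} (hL : Holds h i L)
      (hmem : Entry.snap τ j L' ∈ L) : Holds h j L'

/-- The transaction `x` occurs somewhere in the ledgers held after the views `h`. -/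
def SeenTx {k : ℕ} {Tx : Type} (h : List (View k Tx)) (x : Tx) : Prop :=
  ∃ (j : Fin k) (L : Ledger k Tx), Holds h j L ∧ Entry.tx x ∈ L

/-- What a validator observes in one time step: its view of the underlay ledgers and the
transactions that the environment inputs. -/
abbrev Observation (k : ℕ) (Tx : Type) : Type := View k Tx × List Tx

/-- An entry that an honest validator with the observations `h` is able to create at time `t`:
transactions and certificates cannot be forged, and messages are locked to the current time. -/
def Entry.Sendable {k : ℕ} {Tx : Type} (t : ℕ) (h : List (Observation k Tx)) :
    Entry k Tx → Prop
  | .tx x => SeenTx (h.map Prod.fst) x ∨ ∃ o ∈ h, x ∈ o.2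
  | .note τ _ => τ = t
  | .snap τ j L => τ = t ∧ Holds (h.map Prod.fst) j L

/-- An overlay (interchain) protocol over `k` underlay chains. -/
structure Overlay (k : ℕ) (Tx : Type) where
  /-- `write i t h`: what an honest validator of chain `i` that has observed `h` writes at time
  `t`, as a list of pairs (chain that is written to, entry). -/
  write : Fin k → ℕ → List (Observation k Tx) → List (Fin k × Entry k Tx)
  /-- Honest validators write only what they are able to create. -/
  write_sendable : ∀ i t h j e, (j, e) ∈ write i t h → e.Sendable t h
  /-- `output t h`: the overlay ledger output at time `t` by a client that has had the views `h`
  since it went online. -/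
  output : ℕ → List (View k Tx) → List Tx
  /-- Transactions cannot be forged: a client outputs only transactions that it has seen. -/
  output_seen : ∀ t h, ∀ x ∈ output t h, SeenTx h x

/-- An execution of the overlay protocol `P` in a synchronous network with delay bound `Δ`.
Everything but the behaviour of the honest validators and of the clients is up to the adversary. -/
structure Execution {k : ℕ} {Tx : Type} (P : Overlay k Tx) (Δ : ℕ) where
  /-- The clients: passive external observers. -/
  Client : Type
  /-- The honest validators of all underlay chains. -/
  Validator : Type
  validator_finite : Finite Validator
  /-- The underlay chain that an honest validator belongs to. -/
  home : Validator → Fin k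
  /-- No underlay chain has lost all of its honest validators. -/
  home_surjective : Function.Surjective home
  /-- The time at which a client goes online. -/
  join : Client → ℕ
  /-- The transactions that the environment inputs, at each time, to all honest validators. -/
  env : ℕ → List Tx
  /-- The underlay ledgers in the view of each client and of each honest validator. -/
  view : Client ⊕ Validator → ℕ → View k Tx
  /-- The ledgers of each chain for which a certificate of finality exists by a given time. -/
  cert : Fin k → ℕ → Set (Ledger k Tx)
  cert_mono : ∀ i, Monotone (cert i)
  /-- Time locks are respected. -/
  cert_due : ∀ i t, ∀ L ∈ cert i t, ∀ e ∈ L, e.DueBy t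
  /-- Certificates contained in snapshots cannot be forged. -/
  cert_snap : ∀ i t, ∀ L ∈ cert i t, ∀ τ j L', Entry.snap τ j L' ∈ L → L' ∈ cert j t
  /-- Readers accept only certified ledgers. -/
  view_cert : ∀ r t, Sum.elim join (fun _ => 0) r ≤ t → ∀ i, view r t i ∈ cert i t
  /-- `arrival v t i e`: the time by which all honest validators of chain `i` have received the
  entry `e` that the honest validator `v` writes to `i` at time `t`. -/
  arrival : Validator → ℕ → Fin k → Entry k Tx → ℕ
  arrival_ge : ∀ v t i e, t ≤ arrival v t i e
  arrival_le : ∀ v t i e, arrival v t i e ≤ t + Δ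

namespace Execution

variable {k : ℕ} {Tx : Type} {P : Overlay k Tx} {Δ : ℕ} (E : Execution P Δ)

/-- The time since which a reader is online (honest validators are online from the beginning). -/
def since : E.Client ⊕ E.Validator → ℕ := Sum.elim E.join (fun _ => 0)

/-- What the honest validator `v` has observed up to time `t`. -/
def observed (v : E.Validator) (t : ℕ) : List (Observation k Tx) :=
  (List.range (t + 1)).map fun τ => (E.view (Sum.inr v) τ, E.env τ)

/-- The entry `e` is input at time `a` to all honest validators of chain `i`. -/
def InputAt (i : Fin k) (a : ℕ) (e : Entry k Tx) : Prop :=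
  (∃ x ∈ E.env a, e = Entry.tx x) ∨
    ∃ (v : E.Validator) (t : ℕ),
      (i, e) ∈ P.write (E.home v) t (E.observed v t) ∧ E.arrival v t i e = a

/-- The underlay chain `i` is safe: its certified ledgers (in particular, the ledgers in the views
of any two readers at any two times) are consistent, and no reader's ledger is ever rolled back. -/
def UnderlaySafe (i : Fin k) : Prop :=
  (∀ t t', ∀ L ∈ E.cert i t, ∀ L' ∈ E.cert i t', L <+: L' ∨ L' <+: L) ∧
    ∀ r t t', E.since r ≤ t → t ≤ t' → E.view r t i <+: E.view r t' i

/-- The underlay chain `i` is live with latency `T`. -/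
def UnderlayLive (T : ℕ) (i : Fin k) : Prop :=
  ∀ a e, E.InputAt i a e → ∀ r t', E.since r ≤ t' → a + T ≤ t' → e ∈ E.view r t' i

/-- The overlay ledger output by the client `c` at time `t` (meaningful once `c` is online). -/
def ledger (c : E.Client) (t : ℕ) : List Tx :=
  P.output t ((List.range' (E.join c) (t + 1 - E.join c)).map (E.view (Sum.inl c)))

/-- The overlay is safe. -/
def OverlaySafe : Prop :=
  (∀ c c' t t', E.join c ≤ t → E.join c' ≤ t' →
      E.ledger c t <+: E.ledger c' t' ∨ E.ledger c' t' <+: E.ledger c t) ∧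
    ∀ c t t', E.join c ≤ t → t ≤ t' → E.ledger c t <+: E.ledger c t'

/-- The overlay is live with latency `T`, for clients that have been online for at least `T`. -/
def OverlayLive (T : ℕ) : Prop :=
  ∀ t, ∀ x ∈ E.env t, ∀ c t', E.join c + T ≤ t' → t + T ≤ t' → x ∈ E.ledger c t'

end Execution

/-- One can construct an overlay over `k` underlay chains, for the network delay bound `Δ` and the
underlay latency `T`, that is safe whenever `s` underlays are safe or `b` underlays are both safe
and live, and live with constant latency whenever `l` underlays are live. -/
def Achievable (Tx : Type) (k : ℕ) (Δ T : ℕ) (l s b : ℤ) : Prop :=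
  ∃ (P : Overlay k Tx) (T' : ℕ), ∀ E : Execution P Δ,
    (s ≤ ({i | E.UnderlaySafe i} : Set (Fin k)).ncard ∨
        b ≤ ({i | E.UnderlaySafe i ∧ E.UnderlayLive T i} : Set (Fin k)).ncard → E.OverlaySafe) ∧
      (l ≤ ({i | E.UnderlayLive T i} : Set (Fin k)).ncard → E.OverlayLive T')

end Interchain

/-! Sufficiency runs Dolev–Strong broadcast with the chains as parties and certified snapshots as
signatures. Every time `m` starts a slot. A chain accepts a transaction in slot `m` if it records
it, or a snapshot of a chain that accepted it, before a deadline that grows by one round `R` per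
chain on the relay path. Whether a record is in time is read off the ledger itself: it must precede
every entry locked beyond the deadline. In a late enough view that proves no fork of them, live
chains accept the same set (`Execution.accepted_eq_of_live`): either a chain is already on the path,
or one more round is left, in which an honest validator relays.

A slot is confirmed by a quorum of `q = l` chains, where a provably forked chain counts as agreeing
with anything. If `s` chains are safe, two quorums share a safe chain, since `2 * l + s > 2 * k`. If
`b` chains are safe and live, each quorum contains one of them, since `l + b > k`, and these chains
agree. The live chains form a quorum by themselves, which gives liveness.

Necessity is a split-view attack (`Achievable.attack`). Honest validators see no transactions, and
only the chains in `A` advance. Two clients are shown different transactions, in histories that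
deviate only outside `X` and only outside `Y`; each must believe that `l` chains are live. Chains in
`X ∪ Y` show at most one nonempty history and stay safe, and those in `A` are also live. Disjoint
`X`, `Y` bound `s`; `X = Y = A` bounds `b`. -/

namespace Interchain

variable {k : ℕ} {Tx : Type}

/-! ## Ledgers and their clocks -/

/-- Two ledgers are consistent: one of them is a prefix of the other. -/
def Consistent (L L' : Ledger k Tx) : Prop := L <+: L' ∨ L' <+: L

theorem Consistent.symm {L L' : Ledger k Tx} (h : Consistent L L') : Consistent L' L := Or.symm h

theorem Entry.DueBy.mono {t t' : ℕ} (h : t ≤ t') {e : Entry k Tx} (he : e.DueBy t) :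
    e.DueBy t' := by
  cases e with
  | tx x => trivial
  | note τ d => exact le_trans (show τ ≤ t from he) h
  | snap τ j L => exact le_trans (show τ ≤ t from he) h

open Classical in
/-- The part of a ledger before its first entry that is locked to a time later than `θ`. -/
noncomputable def before (θ : ℕ) (L : Ledger k Tx) : Ledger k Tx :=
  L.takeWhile fun e => decide (e.DueBy θ)

/-- The ledger contains an entry that is locked to a time later than `θ`. -/
def Past (θ : ℕ) (L : Ledger k Tx) : Prop := ∃ e ∈ L, ¬ e.DueBy θ

theorem Past.anti {θ θ' : ℕ} (h : θ ≤ θ') {L : Ledger k Tx} (hL : Past θ' L) : Past θ L := by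
  obtain ⟨e, he, hd⟩ := hL
  exact ⟨e, he, fun hd' => hd (hd'.mono h)⟩

theorem before_eq_self {θ : ℕ} {L : Ledger k Tx} (h : ∀ e ∈ L, e.DueBy θ) : before θ L = L := by
  rw [before, List.takeWhile_eq_self_iff]
  simpa using h

theorem before_subset (θ : ℕ) (L : Ledger k Tx) : before θ L ⊆ L :=
  (List.takeWhile_prefix _).subset

theorem before_mono {θ : ℕ} {L L' : Ledger k Tx} (h : L <+: L') : before θ L <+: before θ L' := by
  classical
  obtain ⟨M, rfl⟩ := h
  unfold before
  rw [List.takeWhile_append]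
  split_ifs with hl
  · exact (List.takeWhile_prefix _).trans (List.prefix_append _ _)
  · exact List.prefix_rfl

theorem before_eq_of_past {θ : ℕ} {L L' : Ledger k Tx} (h : L <+: L') (hL : Past θ L) :
    before θ L' = before θ L := by
  classical
  obtain ⟨M, rfl⟩ := h
  rw [before, List.takeWhile_append, if_neg]
  · rfl
  · intro hl
    have := (List.takeWhile_prefix (fun e : Entry k Tx => decide (e.DueBy θ))).eq_of_length hl
    rw [List.takeWhile_eq_self_iff] at this
    obtain ⟨e, he, hd⟩ := hL
    exact hd (by simpa using this e he)

/-- Only the target has to be past `θ`: if it is the longer ledger, monotonicity suffices; if it is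
the shorter one, its part before `θ` is already frozen. -/
theorem before_prefix_of_consistent {θ : ℕ} {L L' : Ledger k Tx} (h : Consistent L L')
    (hL : Past θ L') : before θ L <+: before θ L' := by
  rcases h with h | h
  · exact before_mono h
  · rw [before_eq_of_past h hL]

/-! ## Relayed transactions -/

/-- The transaction `x` has been relayed along the chains of the list (the most recent one first)
up to the ledger, where the `r`-th chain has recorded it, or a snapshot of the ledger of its
predecessor, before the deadline `σ + r * R`. -/
inductive Relayed (σ R : ℕ) (x : Tx) : List (Fin k) → Ledger k Tx → Prop
  | source {j : Fin k} {L : Ledger k Tx} (h : Entry.tx x ∈ before (σ + R) L) : Relayed σ R x [j] L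
  | relay {i j : Fin k} {A : List (Fin k)} {L L' : Ledger k Tx} {τ : ℕ}
      (hA : Relayed σ R x (i :: A) L') (hj : j ∉ i :: A)
      (h : Entry.snap τ i L' ∈ before (σ + (A.length + 2) * R) L) : Relayed σ R x (j :: i :: A) L

/-- The transactions that the chain `j` accepts in the slot that starts at `σ`. -/
def accepted (σ R : ℕ) (j : Fin k) (L : Ledger k Tx) : Set Tx :=
  {x | ∃ A, Relayed σ R x (j :: A) L}

namespace Relayed

variable {σ R : ℕ} {x : Tx}

theorem nodup {A : List (Fin k)} {L : Ledger k Tx} (h : Relayed σ R x A L) : A.Nodup := by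
  induction h with
  | source h => simp
  | relay hA hj h ih => exact List.nodup_cons.2 ⟨hj, ih⟩

theorem length_le {A : List (Fin k)} {L : Ledger k Tx} (h : Relayed σ R x A L) : A.length ≤ k := by
  simpa using h.nodup.length_le_card

/-- Only the last hop depends on the ledger, as earlier hops are fixed inside the snapshot. Hence
only the last deadline has to have passed. -/
theorem transfer {j : Fin k} {A : List (Fin k)} {L L' : Ledger k Tx}
    (h : Relayed σ R x (j :: A) L) (hc : Consistent L L')
    (hL : Past (σ + (A.length + 1) * R) L') : Relayed σ R x (j :: A) L' := by
  cases h with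
  | source h =>
    refine .source ((before_prefix_of_consistent hc ?_).subset h)
    simpa using hL
  | relay hA hj h => exact .relay hA hj ((before_prefix_of_consistent hc hL).subset h)

/-- Cutting off the most recent hops of a path leaves a path, whose ledger is held through nested
snapshots. -/
theorem exists_of_mem {h : List (View k Tx)} {B : List (Fin k)} {L : Ledger k Tx}
    (hR : Relayed σ R x B L) : ∀ {j : Fin k} {A : List (Fin k)}, B = j :: A → Holds h j L →
      ∀ i ∈ B, ∃ L' A', Holds h i L' ∧ Relayed σ R x (i :: A') L' := by
  induction hR with
  | @source j L hm =>
    rintro j' A hB hL i hi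
    obtain rfl : i = j := by simpa using hi
    cases hB
    exact ⟨L, [], hL, .source hm⟩
  | @relay i₀ j A L L' τ hA hj hm ih =>
    rintro j' A' hB hL i hi
    cases hB
    rcases List.mem_cons.1 hi with rfl | hi
    · exact ⟨L, _, hL, .relay hA hj hm⟩
    · exact ih rfl (hL.nested (before_subset _ _ hm)) i hi

theorem seenTx {h : List (View k Tx)} {B : List (Fin k)} {L : Ledger k Tx}
    (hR : Relayed σ R x B L) : ∀ {j : Fin k} {A : List (Fin k)}, B = j :: A → Holds h j L →
      SeenTx h x := by
  induction hR with
  | @source j L hm =>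
    rintro j' A hB hL
    exact ⟨j', L, hL, before_subset _ _ hm⟩
  | @relay i₀ j A L L' τ hA hj hm ih =>
    rintro j' A' hB hL
    cases hB
    exact ih rfl (hL.nested (before_subset _ _ hm))

end Relayed

theorem accepted_subset_of_consistent {σ R : ℕ} {j : Fin k} {L L' : Ledger k Tx}
    (hc : Consistent L L') (hL : Past (σ + k * R) L') : accepted σ R j L ⊆ accepted σ R j L' := by
  rintro x ⟨A, hA⟩
  -- Paths do not repeat chains, so no deadline exceeds `σ + k * R`.
  exact ⟨A, hA.transfer hc
    (hL.anti (Nat.add_le_add_left (Nat.mul_le_mul_right _ hA.length_le) _))⟩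

theorem accepted_eq_of_consistent {σ R : ℕ} {j : Fin k} {L L' : Ledger k Tx}
    (hc : Consistent L L') (hL : Past (σ + k * R) L) (hL' : Past (σ + k * R) L') :
    accepted σ R j L = accepted σ R j L' :=
  (accepted_subset_of_consistent hc hL').antisymm (accepted_subset_of_consistent hc.symm hL)

/-! ### Held ledgers, and finiteness of what has been seen -/

theorem Holds.mono {h h' : List (View k Tx)} (hh : h ⊆ h') {j : Fin k} {L : Ledger k Tx}
    (hL : Holds h j L) : Holds h' j L := by
  induction hL with
  | read hw j => exact .read (hh hw) j
  | nested _ hmem ih => exact ih.nested hmem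

theorem SeenTx.mono {h h' : List (View k Tx)} (hh : h ⊆ h') {x : Tx} (hx : SeenTx h x) :
    SeenTx h' x := by
  obtain ⟨j, L, hL, hm⟩ := hx
  exact ⟨j, L, hL.mono hh, hm⟩

/-- `Within L' L`: the ledger `L'` is `L` or is nested in `L` by means of snapshots. -/
inductive Within : Ledger k Tx → Ledger k Tx → Prop
  | refl (L : Ledger k Tx) : Within L L
  | nested {L L' L'' : Ledger k Tx} {τ : ℕ} {j : Fin k} (hmem : Entry.snap τ j L' ∈ L)
      (h : Within L'' L') : Within L'' L

theorem Within.snap {L L' L'' : Ledger k Tx} {τ : ℕ} {j : Fin k} (h : Within L' L)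
    (hmem : Entry.snap τ j L'' ∈ L') : Within L'' L := by
  induction h with
  | refl L => exact .nested hmem (.refl _)
  | nested hm _ ih => exact .nested hm (ih hmem)

theorem finite_within (L : Ledger k Tx) : {L' | Within L' L}.Finite := by
  suffices H : ∀ L : Ledger k Tx, {L' | ∃ τ j L'', Entry.snap τ j L'' ∈ L ∧ Within L' L''}.Finite by
    refine ((H L).insert L).subset ?_
    rintro L' (_ | ⟨hm, h⟩)
    · exact Or.inl rfl
    · exact Or.inr ⟨_, _, _, hm, h⟩
  intro L
  -- `Entry` is nested through `List`, so the induction treats entries and ledgers simultaneously.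
  refine Entry.rec_1 (motive_1 := fun e => {L' | ∃ τ j L'', e = Entry.snap τ j L'' ∧
    Within L' L''}.Finite) (motive_2 := fun L => {L' | ∃ τ j L'', Entry.snap τ j L'' ∈ L ∧
    Within L' L''}.Finite) ?_ ?_ ?_ ?_ ?_ L
  · intro x; simp
  · intro x; simp
  · intro τ j L hL
    refine (hL.insert L).subset ?_
    rintro L' ⟨_, _, _, h, hw⟩
    cases h
    rcases hw with _ | ⟨hm, h⟩
    · exact Or.inl rfl
    · exact Or.inr ⟨_, _, _, hm, h⟩
  · simp
  · intro e L he hL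
    refine (he.union hL).subset ?_
    rintro L' ⟨τ, j, L'', hm, hw⟩
    rcases List.mem_cons.1 hm with h | h
    · exact Or.inl ⟨τ, j, L'', h.symm, hw⟩
    · exact Or.inr ⟨τ, j, L'', h, hw⟩

theorem Holds.exists_within {h : List (View k Tx)} {j : Fin k} {L : Ledger k Tx}
    (hL : Holds h j L) : ∃ w ∈ h, ∃ i, Within L (w i) := by
  induction hL with
  | @read w hw j => exact ⟨w, hw, j, .refl _⟩
  | nested _ hmem ih =>
    obtain ⟨w, hw, i, hi⟩ := ih
    exact ⟨w, hw, i, hi.snap hmem⟩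

/-- Needed because `listOf` returns `[]` on an infinite set, which would lose a whole slot. -/
theorem finite_seenTx (h : List (View k Tx)) : {x | SeenTx h x}.Finite := by
  have : (⋃ w ∈ h, ⋃ i, ⋃ L ∈ {L | Within L (w i)}, {x : Tx | Entry.tx x ∈ L}).Finite := by
    refine h.finite_toSet.biUnion fun w _ => Set.finite_iUnion fun i =>
      (finite_within (w i)).biUnion fun L _ => ?_
    exact Set.Finite.preimage (fun _ _ _ _ h => Entry.tx.inj h) L.finite_toSet
  refine this.subset ?_
  rintro x ⟨j, L, hL, hx⟩
  obtain ⟨w, hw, i, hi⟩ := hL.exists_within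
  simp only [Set.mem_iUnion]
  exact ⟨w, hw, i, L, hi, hx⟩

/-! ## Concatenation of slots -/

open Classical in
/-- The elements of a finite set as a list. -/
noncomputable def listOf {α : Type*} (S : Set α) : List α :=
  if h : S.Finite then h.toFinset.toList else []

theorem mem_of_mem_listOf {α : Type*} {S : Set α} {x : α} (h : x ∈ listOf S) : x ∈ S := by
  unfold listOf at h
  split_ifs at h with hS
  · simpa using h
  · simp at h

theorem mem_listOf {α : Type*} {S : Set α} (hS : S.Finite) {x : α} (h : x ∈ S) : x ∈ listOf S := by
  simpa [listOf, hS] using h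

theorem listOf_empty {α : Type*} : listOf (∅ : Set α) = [] := by simp [listOf]

/-- The elements of `S 0`, …, `S (n - 1)` in this order, without repetitions. -/
noncomputable def sequence {α : Type*} (S : ℕ → Set α) : ℕ → List α
  | 0 => []
  | n + 1 => sequence S n ++ listOf (S n \ {x | x ∈ sequence S n})

section sequence

variable {α : Type*} {S S' : ℕ → Set α}

theorem exists_of_mem_sequence {n : ℕ} {x : α} (h : x ∈ sequence S n) : ∃ m < n, x ∈ S m := by
  induction n with
  | zero => simp [sequence] at h
  | succ n ih =>
    rcases List.mem_append.1 h with h | h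
    · obtain ⟨m, hm, hx⟩ := ih h
      exact ⟨m, by omega, hx⟩
    · exact ⟨n, by omega, (mem_of_mem_listOf h).1⟩

theorem sequence_prefix {n n' : ℕ} (h : n ≤ n') : sequence S n <+: sequence S n' := by
  induction h with
  | refl => exact List.prefix_rfl
  | step _ ih => exact ih.trans (List.prefix_append _ _)

theorem mem_sequence {m n : ℕ} {x : α} (hS : (S m).Finite) (hm : m < n) (hx : x ∈ S m) :
    x ∈ sequence S n := by
  refine (sequence_prefix (show m + 1 ≤ n from hm)).subset (List.mem_append.2 ?_)
  by_cases h : x ∈ sequence S m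
  · exact Or.inl h
  · exact Or.inr (mem_listOf hS.sdiff ⟨hx, h⟩)

theorem sequence_congr {n : ℕ} (h : ∀ m < n, S m = S' m) : sequence S n = sequence S' n := by
  induction n with
  | zero => rfl
  | succ n ih =>
    rw [sequence, sequence, ih fun m hm => h m (by omega), h n (by omega)]

theorem sequence_eq_of_empty {N n : ℕ} (hN : N ≤ n) (h : ∀ m, N ≤ m → m < n → S m = ∅) :
    sequence S n = sequence S N := by
  induction hN with
  | refl => rfl
  | @step n hn ih =>
    rw [sequence, ih fun m h₁ h₂ => h m h₁ (by omega), h n hn (by omega)]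
    simp [listOf_empty]

end sequence

/-- A confirmation covers all slots below `n`, so the slots confirmed for a client form an initial
segment; `N` is its length, cut off at `t`. -/
theorem exists_lt_iff_of_downward {p : ℕ → Prop} (hp : ∀ m, p (m + 1) → p m) (t : ℕ) :
    ∃ N ≤ t, ∀ m < t, m < N ↔ p m := by
  induction t with
  | zero => exact ⟨0, le_rfl, by simp⟩
  | succ t ih =>
    obtain ⟨N, hN, h⟩ := ih
    by_cases ht : p t
    · have hall : ∀ i ≤ t, p (t - i) := by
        intro i
        induction i with
        | zero => intro _; simpa using ht
        | succ i ih' =>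
          intro hi
          have := ih' (by omega)
          rw [show t - i = t - (i + 1) + 1 by omega] at this
          exact hp _ this
      refine ⟨t + 1, le_rfl, fun m hm => ⟨fun _ => ?_, fun _ => hm⟩⟩
      have := hall (t - m) (by omega)
      rwa [show t - (t - m) = m by omega] at this
    · refine ⟨N, by omega, fun m hm => ?_⟩
      rcases Nat.lt_succ_iff_lt_or_eq.1 hm with hm | rfl
      · exact h m hm
      · exact ⟨fun h => absurd h (by omega), fun h => absurd h ht⟩

/-! ## The protocol -/

/-- Whoever reads `w` holds a proof that the chain `j` is not safe. -/
def Forked (w : View k Tx) (j : Fin k) : Prop :=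
  ∃ L L', Holds [w] j L ∧ Holds [w] j L' ∧ ¬ Consistent L L'

/-- In the view `w`, all but at most `k - q` chains are provably unsafe or accept exactly the
transactions `D m` in each slot `m < n`, where all deadlines of these slots have passed. -/
def Confirmed (q R : ℕ) (w : View k Tx) (n : ℕ) (D : ℕ → Set Tx) : Prop :=
  (∀ m < n, ∀ x ∈ D m, SeenTx [w] x) ∧ ∃ Q : Finset (Fin k), q ≤ Q.card ∧
    ∀ j ∈ Q, Forked w j ∨ ∀ m < n, Past (m + k * R) (w j) ∧ D m = accepted m R j (w j)

/-- The transactions that are confirmed for slot `m` in one of the views `h`. -/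
def decided (q R : ℕ) (h : List (View k Tx)) (m : ℕ) : Set Tx :=
  {x | ∃ w ∈ h, ∃ n D, m < n ∧ Confirmed q R w n D ∧ x ∈ D m}

/-- This is why `Confirmed` demands seen transactions explicitly: a quorum of forked chains puts no
constraint on `D`. -/
theorem seenTx_of_mem_decided {q R : ℕ} {h : List (View k Tx)} {m : ℕ} {x : Tx}
    (hx : x ∈ decided q R h m) : SeenTx h x := by
  obtain ⟨w, hw, n, D, hm, hD, hx⟩ := hx
  exact (hD.1 m hm x hx).mono (by simpa using hw)

/-- At each time, honest validators write to every chain a clock tick and snapshots of all the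
ledgers that they see.  Clients output the confirmed transactions, slot by slot. -/
noncomputable def relayOverlay (k : ℕ) (Tx : Type) (q R : ℕ) : Overlay k Tx where
  write _ t h := (List.finRange k).flatMap fun j => (j, .note t 0) ::
    h.getLast?.toList.flatMap fun o => (List.finRange k).map fun i => (j, .snap t i (o.1 i))
  write_sendable i t h j e he := by
    simp only [List.mem_flatMap, List.mem_cons, List.mem_map, Option.mem_toList] at he
    obtain ⟨j', -, he | ⟨o, ho, i', -, he⟩⟩ := he
    · cases he
      rfl
    · cases he
      exact ⟨rfl, .read (List.mem_map_of_mem (List.mem_of_getLast? ho)) i'⟩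
  output t h := sequence (decided q R h) t
  output_seen t h x hx := by
    obtain ⟨m, -, hx⟩ := exists_of_mem_sequence hx
    exact seenTx_of_mem_decided hx

namespace Execution

section General

variable {P : Overlay k Tx} {Δ : ℕ} (E : Execution P Δ)

theorem cert_of_holds {M : ℕ} {h : List (View k Tx)}
    (hh : ∀ w ∈ h, ∀ i, w i ∈ E.cert i M) {j : Fin k} {L : Ledger k Tx} (hL : Holds h j L) :
    L ∈ E.cert j M := by
  induction hL with
  | read hw j => exact hh _ hw j
  | nested _ hmem ih => exact E.cert_snap _ _ _ ih _ _ _ hmem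

theorem not_forked_of_underlaySafe {j : Fin k} (hj : E.UnderlaySafe j) {r : E.Client ⊕ E.Validator}
    {t : ℕ} (ht : E.since r ≤ t) : ¬ Forked (E.view r t) j := by
  rintro ⟨L, L', hL, hL', hc⟩
  have hh : ∀ w ∈ [E.view r t], ∀ i, w i ∈ E.cert i t := by
    simpa using E.view_cert r t ht
  exact hc (hj.1 t t L (E.cert_of_holds hh hL) L' (E.cert_of_holds hh hL'))

theorem UnderlaySafe.consistent_view {E : Execution P Δ} {j : Fin k} (hj : E.UnderlaySafe j)
    {r r' : E.Client ⊕ E.Validator} {t t' : ℕ} (ht : E.since r ≤ t) (ht' : E.since r' ≤ t') :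
    Consistent (E.view r t j) (E.view r' t' j) :=
  hj.1 t t' _ (E.view_cert r t ht j) _ (E.view_cert r' t' ht' j)

theorem view_due {r : E.Client ⊕ E.Validator} {t : ℕ} (ht : E.since r ≤ t) (j : Fin k) :
    ∀ e ∈ E.view r t j, e.DueBy t :=
  E.cert_due j t _ (E.view_cert r t ht j)

end General

/-! ### Agreement among live chains -/

variable {q R Δ T : ℕ} (E : Execution (relayOverlay k Tx q R) Δ)

theorem past_of_live {j : Fin k} (hj : E.UnderlayLive T j) (v : E.Validator)
    {r : E.Client ⊕ E.Validator} {θ t : ℕ} (ht : E.since r ≤ t) (hθ : θ + (Δ + T + 1) ≤ t) :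
    Past θ (E.view r t j) := by
  -- The first tick beyond `θ` is written at `θ + 1`, arrives within `Δ` and is recorded within `T`.
  refine ⟨.note (θ + 1) 0, hj (E.arrival v (θ + 1) j (.note (θ + 1) 0)) _
    (Or.inr ⟨v, θ + 1, ?_, rfl⟩) r t ht ?_, fun h => ?_⟩
  · simp [relayOverlay]
  · have := E.arrival_le v (θ + 1) j (.note (θ + 1) 0)
    omega
  · exact absurd (show θ + 1 ≤ θ from h) (by omega)

theorem snap_mem_of_live {j : Fin k} (hj : E.UnderlayLive T j) (v : E.Validator)
    {r : E.Client ⊕ E.Validator} {s t : ℕ} (ht : E.since r ≤ t) (hs : s + (Δ + T + 1) ≤ t)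
    (i : Fin k) : Entry.snap s i (E.view (Sum.inr v) s i) ∈ E.view r t j := by
  refine hj (E.arrival v s j (.snap s i (E.view (Sum.inr v) s i))) _
    (Or.inr ⟨v, s, ?_, rfl⟩) r t ht ?_
  · have : (E.observed v s).getLast? = some (E.view (Sum.inr v) s, E.env s) := by
      simp [observed, List.range_succ]
    simpa [relayOverlay] using ⟨_, ⟨_, this⟩, rfl⟩
  · have := E.arrival_le v s j (.snap s i (E.view (Sum.inr v) s i))
    omega

/-- The validator's ledger of `j` reaches the reader as a snapshot on the live chain `i`, so an
inconsistency would put a proof of the fork into the reader's hands. This substitutes for safety of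
`j`. -/
theorem consistent_of_not_forked {i j : Fin k} (hi : E.UnderlayLive T i) (v : E.Validator)
    {r : E.Client ⊕ E.Validator} {s t : ℕ} (ht : E.since r ≤ t) (hs : s + (Δ + T + 1) ≤ t)
    (hj : ¬ Forked (E.view r t) j) :
    Consistent (E.view (Sum.inr v) s j) (E.view r t j) := by
  by_contra hc
  exact hj ⟨_, _, (Holds.read (List.mem_singleton_self _) i).nested (E.snap_mem_of_live hi v ht hs j),
    .read (List.mem_singleton_self _) j, hc⟩

theorem accepted_subset_of_live {j j' : Fin k} (hj : E.UnderlayLive T j)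
    (hj' : E.UnderlayLive T j') (v : E.Validator) {r : E.Client ⊕ E.Validator} {m t : ℕ}
    (ht : E.since r ≤ t) (hR : R = 2 * (Δ + T + 1)) (hm : m + k * R + 3 * (Δ + T + 1) ≤ t)
    (hF : ¬ Forked (E.view r t) j) (hF' : ¬ Forked (E.view r t) j') :
    accepted m R j (E.view r t j) ⊆ accepted m R j' (E.view r t j') := by
  rintro x ⟨A, hA⟩
  by_cases hmem : j' ∈ j :: A
  · obtain ⟨L', A', hL', hA'⟩ := hA.exists_of_mem rfl
      (Holds.read (List.mem_singleton_self (E.view r t)) j) j' hmem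
    refine ⟨A', hA'.transfer ?_ ?_⟩
    · by_contra hc
      exact hF' ⟨_, _, hL', .read (List.mem_singleton_self _) j', hc⟩
    · refine E.past_of_live hj' v ht ?_
      have := Nat.mul_le_mul_right R hA'.length_le
      simp only [List.length_cons] at this
      omega
  -- The path misses `j'`, so it has fewer than `k` chains and another deadline remains.
  · have hlen : (A.length + 2) * R ≤ k * R := by
      refine Nat.mul_le_mul_right R ?_
      have := (List.nodup_cons.2 ⟨hmem, hA.nodup⟩).length_le_card
      rwa [Fintype.card_fin] at this
    have hsucc : (A.length + 2) * R = (A.length + 1) * R + R := by ring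
    set θ := m + (A.length + 1) * R with hθ
    have hs : E.since (Sum.inr v) = 0 := rfl
    -- Half of `R` lets the validator see that the deadline `θ` has passed on `j`; the other half
    -- lets its snapshot be recorded on `j'`.
    have h₁ : Relayed m R x (j :: A) (E.view (Sum.inr v) (θ + (Δ + T + 1)) j) :=
      hA.transfer (E.consistent_of_not_forked hj v ht (by omega) hF).symm
        (E.past_of_live hj v (by omega) le_rfl)
    have h₂ := E.snap_mem_of_live hj' v (r := Sum.inr v) (s := θ + (Δ + T + 1))
      (t := θ + R) (by omega) (by omega) j
    -- All that is visible at `θ + R` is due by then, so the snapshot meets the next deadline.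
    rw [← before_eq_self (E.view_due (r := Sum.inr v) (t := θ + R) (by omega) j')] at h₂
    have h₃ := (before_prefix_of_consistent
      (E.consistent_of_not_forked hj' v ht (s := θ + R) (by omega) hF')
      (E.past_of_live hj' v ht (by omega))).subset h₂
    refine ⟨j :: A, .relay h₁ hmem (τ := θ + (Δ + T + 1)) ?_⟩
    rwa [show m + (A.length + 2) * R = θ + R by omega]

theorem accepted_eq_of_live {j j' : Fin k} (hj : E.UnderlayLive T j)
    (hj' : E.UnderlayLive T j') (v : E.Validator) {r : E.Client ⊕ E.Validator} {m t : ℕ}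
    (ht : E.since r ≤ t) (hR : R = 2 * (Δ + T + 1)) (hm : m + k * R + 3 * (Δ + T + 1) ≤ t)
    (hF : ¬ Forked (E.view r t) j) (hF' : ¬ Forked (E.view r t) j') :
    accepted m R j (E.view r t j) = accepted m R j' (E.view r t j') :=
  (E.accepted_subset_of_live hj hj' v ht hR hm hF hF').antisymm
    (E.accepted_subset_of_live hj' hj v ht hR hm hF' hF)

/-! ### Safety -/

/-- Without conflicting confirmations there is one global slot sequence `S`, and each output is an
initial segment of it that never shrinks. -/
theorem overlaySafe_of_agree
    (agree : ∀ c t c' t' n D n' D', E.join c ≤ t → E.join c' ≤ t' →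
      Confirmed q R (E.view (Sum.inl c) t) n D → Confirmed q R (E.view (Sum.inl c') t') n' D' →
      ∀ m < n, m < n' → D m = D' m) : E.OverlaySafe := by
  let S : ℕ → Set Tx := fun m =>
    {x | ∃ c t n D, E.join c ≤ t ∧ m < n ∧ Confirmed q R (E.view (Sum.inl c) t) n D ∧ x ∈ D m}
  let p : E.Client → ℕ → ℕ → Prop := fun c t m =>
    ∃ u n D, E.join c ≤ u ∧ u ≤ t ∧ m < n ∧ Confirmed q R (E.view (Sum.inl c) u) n D
  have mem_history : ∀ c t w, w ∈ (List.range' (E.join c) (t + 1 - E.join c)).map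
      (E.view (Sum.inl c)) ↔ ∃ u, E.join c ≤ u ∧ u ≤ t ∧ E.view (Sum.inl c) u = w := by
    intro c t w
    simp only [List.mem_map, List.mem_range'_1]
    constructor
    · rintro ⟨u, hu, rfl⟩
      exact ⟨u, hu.1, by omega, rfl⟩
    · rintro ⟨u, hu, hu', rfl⟩
      exact ⟨u, ⟨hu, by omega⟩, rfl⟩
  have key : ∀ c t, ∃ N ≤ t, (∀ m < t, m < N ↔ p c t m) ∧ E.ledger c t = sequence S N := by
    intro c t
    obtain ⟨N, hN, h⟩ := exists_lt_iff_of_downward (p := p c t)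
      (by rintro m ⟨u, n, D, h₁, h₂, h₃, h₄⟩; exact ⟨u, n, D, h₁, h₂, by omega, h₄⟩) t
    refine ⟨N, hN, h, ?_⟩
    change sequence (decided q R _) t = _
    rw [sequence_eq_of_empty hN]
    · refine sequence_congr fun m hm => ?_
      obtain ⟨u, n, D, h₁, h₂, h₃, h₄⟩ := (h m (by omega)).1 hm
      ext x
      constructor
      · rintro ⟨w, hw, n', D', hm', hD', hx⟩
        obtain ⟨u', hu', -, rfl⟩ := (mem_history c t w).1 hw
        exact ⟨c, u', n', D', hu', hm', hD', hx⟩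
      · rintro ⟨c', u', n', D', hu', hm', hD', hx⟩
        refine ⟨_, (mem_history c t _).2 ⟨u, h₁, h₂, rfl⟩, n, D, h₃, h₄, ?_⟩
        rwa [agree c u c' u' n D n' D' h₁ hu' h₄ hD' m h₃ hm']
    · intro m hNm hm
      rw [Set.eq_empty_iff_forall_notMem]
      rintro x ⟨w, hw, n', D', hm', hD', hx⟩
      obtain ⟨u', hu', hut, rfl⟩ := (mem_history c t w).1 hw
      exact absurd ((h m hm).2 ⟨u', n', D', hu', hut, hm', hD'⟩) (by omega)
  refine ⟨fun c c' t t' _ _ => ?_, fun c t t' _ htt' => ?_⟩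
  · obtain ⟨N, -, -, h⟩ := key c t
    obtain ⟨N', -, -, h'⟩ := key c' t'
    rw [h, h']
    exact (le_total N N').imp sequence_prefix sequence_prefix
  · obtain ⟨N, hN, hp, h⟩ := key c t
    obtain ⟨N', -, hp', h'⟩ := key c t'
    rw [h, h']
    refine sequence_prefix ?_
    by_contra hlt
    obtain ⟨u, n, D, h₁, h₂, h₃⟩ := (hp N' (by omega)).1 (by omega)
    exact absurd ((hp' N' (by omega)).2 ⟨u, n, D, h₁, h₂.trans htt', h₃⟩) (by omega)

theorem exists_mem_of_card {Q : Finset (Fin k)} {S : Set (Fin k)} (h : k < Q.card + S.ncard) :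
    ∃ j ∈ Q, j ∈ S := by
  classical
  by_contra! hn
  rw [Set.ncard_eq_toFinset_card'] at h
  have hd : Disjoint Q S.toFinset := by
    rw [Finset.disjoint_left]
    intro j hj hS
    exact hn j hj (by simpa using hS)
  have := Finset.card_le_univ (Q ∪ S.toFinset)
  rw [Finset.card_union_of_disjoint hd, Fintype.card_fin] at this
  omega

theorem exists_mem_inter_of_card {Q Q' : Finset (Fin k)} {S : Set (Fin k)}
    (h : 2 * k < Q.card + Q'.card + S.ncard) : ∃ j ∈ Q, j ∈ Q' ∧ j ∈ S := by
  classical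
  have h₁ := Finset.card_union_add_card_inter Q Q'
  have h₂ := Finset.card_le_univ (Q ∪ Q')
  rw [Fintype.card_fin] at h₂
  obtain ⟨j, hj, hS⟩ := exists_mem_of_card (Q := Q ∩ Q') (S := S) (by omega)
  rw [Finset.mem_inter] at hj
  exact ⟨j, hj.1, hj.2, hS⟩

theorem overlaySafe_of_safe
    (h : 2 * k < 2 * q + ({i | E.UnderlaySafe i} : Set (Fin k)).ncard) : E.OverlaySafe := by
  refine E.overlaySafe_of_agree fun c t c' t' n D n' D' ht ht' hD hD' m hm hm' => ?_
  obtain ⟨-, Q, hQ, hD⟩ := hD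
  obtain ⟨-, Q', hQ', hD'⟩ := hD'
  obtain ⟨j, hj, hj', hs⟩ := exists_mem_inter_of_card (Q := Q) (Q' := Q')
    (S := {i | E.UnderlaySafe i}) (by omega)
  obtain ⟨hp, hd⟩ := (hD j hj).resolve_left
    (E.not_forked_of_underlaySafe hs (r := Sum.inl c) ht) m hm
  obtain ⟨hp', hd'⟩ := (hD' j hj').resolve_left
    (E.not_forked_of_underlaySafe hs (r := Sum.inl c') ht') m hm'
  rw [hd, hd']
  exact accepted_eq_of_consistent
    (UnderlaySafe.consistent_view hs (r := Sum.inl c) (r' := Sum.inl c') ht ht') hp hp'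

theorem overlaySafe_of_safe_live (hR : R = 2 * (Δ + T + 1)) (h : k < q +
    ({i | E.UnderlaySafe i ∧ E.UnderlayLive T i} : Set (Fin k)).ncard) : E.OverlaySafe := by
  refine E.overlaySafe_of_agree fun c t c' t' n D n' D' ht ht' hD hD' m hm hm' => ?_
  obtain ⟨-, Q, hQ, hD⟩ := hD
  obtain ⟨-, Q', hQ', hD'⟩ := hD'
  obtain ⟨j, hj, hs, hl⟩ := exists_mem_of_card (Q := Q)
    (S := {i | E.UnderlaySafe i ∧ E.UnderlayLive T i}) (by omega)
  obtain ⟨j', hj', hs', hl'⟩ := exists_mem_of_card (Q := Q')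
    (S := {i | E.UnderlaySafe i ∧ E.UnderlayLive T i}) (by omega)
  obtain ⟨hp, hd⟩ := (hD j hj).resolve_left
    (E.not_forked_of_underlaySafe hs (r := Sum.inl c) ht) m hm
  obtain ⟨hp', hd'⟩ := (hD' j' hj').resolve_left
    (E.not_forked_of_underlaySafe hs' (r := Sum.inl c') ht') m hm'
  obtain ⟨v, -⟩ := E.home_surjective j
  have hv : ∀ u, E.since (Sum.inr v) ≤ u := fun u => Nat.zero_le u
  -- The clients may have read too early for agreement within their own views. Safety carries both
  -- sets to one validator's view at the late time `M`.
  let M := m + k * R + 3 * (Δ + T + 1)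
  rw [hd, hd', accepted_eq_of_consistent
      (UnderlaySafe.consistent_view hs (r := Sum.inl c) ht (hv M)) hp
      (E.past_of_live hl v (hv M) (by omega)),
    accepted_eq_of_consistent
      (UnderlaySafe.consistent_view hs' (r := Sum.inl c') ht' (hv M)) hp'
      (E.past_of_live hl' v (hv M) (by omega))]
  exact E.accepted_eq_of_live hl hl' v (hv M) hR le_rfl
    (E.not_forked_of_underlaySafe hs (hv M)) (E.not_forked_of_underlaySafe hs' (hv M))

/-! ### Liveness -/

theorem overlayLive_of_live (hR : R = 2 * (Δ + T + 1)) (hq : 1 ≤ q)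
    (h : q ≤ ({i | E.UnderlayLive T i} : Set (Fin k)).ncard) :
    E.OverlayLive (k * R + 3 * (Δ + T + 1)) := by
  classical
  intro u x hx c t hc ht
  obtain ⟨i, hi⟩ : ({i | E.UnderlayLive T i} : Set (Fin k)).Nonempty :=
    Set.nonempty_of_ncard_ne_zero (by omega)
  obtain ⟨v, -⟩ := E.home_surjective i
  have hjt : E.since (Sum.inl c) ≤ t := le_trans (Nat.le_add_right _ _) hc
  set w := E.view (Sum.inl c) t with hw
  have hk : 1 ≤ k := i.pos
  have hkR : R ≤ k * R := Nat.le_mul_of_pos_left R hk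
  -- The common set of the live chains not provably forked; if all of them are forked, it is
  -- everything seen.
  let D : ℕ → Set Tx := fun m =>
    {y | SeenTx [w] y ∧ ∀ j, E.UnderlayLive T j → ¬ Forked w j → y ∈ accepted m R j (w j)}
  have hconf : Confirmed q R w (u + 1) D := by
    refine ⟨fun m _ y hy => hy.1, ({i | E.UnderlayLive T i} : Set (Fin k)).toFinset, ?_, ?_⟩
    · rwa [← Set.ncard_eq_toFinset_card']
    · intro j hj
      replace hj : E.UnderlayLive T j := by simpa using hj
      refine or_iff_not_imp_left.2 fun hF m hm => ⟨E.past_of_live hj v hjt (by omega), ?_⟩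
      ext y
      constructor
      · exact fun hy => hy.2 j hj hF
      · intro hy
        refine ⟨?_, fun j' hj' hF' =>
          E.accepted_subset_of_live hj hj' v hjt hR (by omega) hF hF' hy⟩
        obtain ⟨A, hA⟩ := hy
        exact hA.seenTx rfl (.read (List.mem_singleton_self _) j)
  have hxD : x ∈ D u := by
    have hin : ∀ j, E.UnderlayLive T j → ∀ r t', E.since r ≤ t' → u + T ≤ t' →
        Entry.tx x ∈ E.view r t' j := fun j hj => hj u _ (Or.inl ⟨x, hx, rfl⟩)
    refine ⟨⟨i, w i, .read (List.mem_singleton_self _) i, hin i hi _ _ hjt (by omega)⟩, ?_⟩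
    intro j hj hF
    have hz : E.since (Sum.inr v) ≤ u + T := Nat.zero_le _
    -- A validator sees `x` at `u + T`, and all entries visible then are due before the first
    -- deadline `u + R`.
    have h₁ := hin j hj (Sum.inr v) (u + T) hz le_rfl
    rw [← before_eq_self (θ := u + R)
      fun e he => (E.view_due hz j e he).mono (show u + T ≤ u + R by omega)] at h₁
    exact ⟨[], .source ((before_prefix_of_consistent
      (E.consistent_of_not_forked hj v hjt (by omega) hF)
      (E.past_of_live hj v hjt (by omega))).subset h₁)⟩
  refine mem_sequence ((finite_seenTx _).subset fun y hy => seenTx_of_mem_decided hy)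
    (show u < t by omega) ⟨w, ?_, u + 1, D, by omega, hconf, hxD⟩
  refine List.mem_map_of_mem (List.mem_range'_1.2 ?_)
  change E.join c ≤ t at hjt
  omega

end Execution

/-! ### Sufficiency of the bounds -/

theorem achievable_of_le {Δ T : ℕ} {l s b : ℤ} (hl : 1 ≤ l) (hs : 2 * (k - l) + 1 ≤ s)
    (hb : k - l + 1 ≤ b) : Achievable Tx k Δ T l s b := by
  refine ⟨relayOverlay k Tx l.toNat (2 * (Δ + T + 1)), k * (2 * (Δ + T + 1)) + 3 * (Δ + T + 1),
    fun E => ⟨?_, fun h => E.overlayLive_of_live rfl (by omega) (by omega)⟩⟩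
  rintro (h | h)
  · exact E.overlaySafe_of_safe (by omega)
  · exact E.overlaySafe_of_safe_live rfl (by omega)

/-! ## Simulated histories of the underlay ledgers -/

section Simulation

variable (P : Overlay k Tx) (Λ : Set (Fin k)) (ext : ℕ → View k Tx) (env : ℕ → List Tx)

/-- The entries that one validator per chain, all with the observations `h`, and the environment
with the input `xs` write to chain `i` at time `t`. -/
def emitted (t : ℕ) (h : List (Observation k Tx)) (xs : List Tx) (i : Fin k) : Ledger k Tx :=
  xs.map .tx ++ (List.finRange k).flatMap fun v =>
    ((P.write v t h).filter fun p => p.1 = i).map Prod.snd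

open Classical in
/-- The observations up to time `t` and the ledgers at time `t`, where the chains in `Λ` record all
inputs immediately, and the other ones have the ledgers `ext`. -/
noncomputable def trace : ℕ → List (Observation k Tx) × View k Tx
  | 0 =>
    let w : View k Tx := fun i => if i ∈ Λ then [] else ext 0 i
    ([(w, env 0)], w)
  | t + 1 =>
    let w : View k Tx := fun i =>
      if i ∈ Λ then (trace t).2 i ++ emitted P t (trace t).1 (env t) i else ext (t + 1) i
    ((trace t).1 ++ [(w, env (t + 1))], w)

/-- The ledgers at time `t` of the simulation `trace`. -/
noncomputable def run (t : ℕ) : View k Tx := (trace P Λ ext env t).2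

/-- The observations of a validator with the views `V`. -/
def observations (V : ℕ → View k Tx) (t : ℕ) : List (Observation k Tx) :=
  (List.range (t + 1)).map fun τ => (V τ, env τ)

theorem trace_fst (t : ℕ) :
    (trace P Λ ext env t).1 = observations env (run P Λ ext env) t := by
  induction t with
  | zero => rfl
  | succ t ih =>
    rw [observations, List.range_succ, List.map_append, ← observations, ← ih]
    rfl

variable {P Λ ext env}

theorem run_of_notMem {i : Fin k} (hi : i ∉ Λ) (t : ℕ) : run P Λ ext env t i = ext t i := by
  cases t <;> simp [run, trace, hi]

theorem run_zero {i : Fin k} (hi : i ∈ Λ) : run P Λ ext env 0 i = [] := by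
  simp [run, trace, hi]

theorem run_succ {i : Fin k} (hi : i ∈ Λ) (t : ℕ) :
    run P Λ ext env (t + 1) i = run P Λ ext env t i ++
      emitted P t (observations env (run P Λ ext env) t) (env t) i := by
  rw [← trace_fst]
  simp [run, trace, hi]

end Simulation

/-- The ledgers `V` grow, respect time locks, contain only snapshots of each other, and only
transactions in `S`. -/
structure Lawful (S : Set Tx) (V : ℕ → View k Tx) : Prop where
  mono : ∀ i t t', t ≤ t' → V t i <+: V t' i
  due : ∀ t i, ∀ e ∈ V t i, e.DueBy t
  snap : ∀ t i τ j L, Entry.snap τ j L ∈ V t i → ∃ t' ≤ t, V t' j = L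
  tx : ∀ t i x, Entry.tx x ∈ V t i → x ∈ S

theorem Lawful.superset {S S' : Set Tx} (hS : S ⊆ S') {V : ℕ → View k Tx} (h : Lawful S V) :
    Lawful S' V :=
  ⟨h.mono, h.due, h.snap, fun t i x hx => hS (h.tx t i x hx)⟩

theorem lawful_nil (S : Set Tx) : Lawful S (fun _ _ => [] : ℕ → View k Tx) :=
  ⟨by simp, by simp, by simp, by simp⟩

theorem exists_of_holds {V : ℕ → View k Tx} {t : ℕ}
    (hV : ∀ t' ≤ t, ∀ i τ j L, Entry.snap τ j L ∈ V t' i → ∃ u ≤ t', V u j = L)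
    {h : List (View k Tx)} (hh : ∀ w ∈ h, ∃ u ≤ t, V u = w) {j : Fin k} {L : Ledger k Tx}
    (hL : Holds h j L) : ∃ u ≤ t, V u j = L := by
  induction hL with
  | read hw j =>
    obtain ⟨u, hu, rfl⟩ := hh _ hw
    exact ⟨u, hu, rfl⟩
  | nested _ hmem ih =>
    obtain ⟨u, hu, rfl⟩ := ih
    obtain ⟨u', hu', h⟩ := hV u hu _ _ _ _ hmem
    exact ⟨u', hu'.trans hu, h⟩

theorem Lawful.mem_of_seenTx {S : Set Tx} {V : ℕ → View k Tx} (hV : Lawful S V) {t : ℕ}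
    {h : List (View k Tx)} (hh : ∀ w ∈ h, ∃ u ≤ t, V u = w) {x : Tx} (hx : SeenTx h x) : x ∈ S := by
  obtain ⟨j, L, hL, hm⟩ := hx
  obtain ⟨u, -, rfl⟩ := exists_of_holds (fun t' _ => hV.snap t') hh hL
  exact hV.tx _ _ _ hm

theorem mem_emitted {P : Overlay k Tx} {t : ℕ} {h : List (Observation k Tx)} {xs : List Tx}
    {i : Fin k} {e : Entry k Tx} :
    e ∈ emitted P t h xs i ↔ (∃ x ∈ xs, e = .tx x) ∨ ∃ v, (i, e) ∈ P.write v t h := by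
  simp [emitted, eq_comm]

theorem lawful_run {P : Overlay k Tx} {Λ : Set (Fin k)} {ext : ℕ → View k Tx} {env : ℕ → List Tx}
    {S : Set Tx} (hext : Lawful S ext) (hnil : ∀ t, ∀ i ∈ Λ, ext t i = [])
    (henv : ∀ t, ∀ x ∈ env t, x ∈ S) : Lawful S (run P Λ ext env) := by
  set V := run P Λ ext env with hV
  have main : ∀ t, ∀ t' ≤ t, ∀ i, ∀ e ∈ V t' i, e.DueBy t' ∧
      (∀ τ j L, e = .snap τ j L → ∃ u ≤ t', V u j = L) ∧ ∀ x, e = .tx x → x ∈ S := by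
    have out : ∀ t, ∀ i ∉ Λ, ∀ e ∈ V t i, e.DueBy t ∧
        (∀ τ j L, e = .snap τ j L → ∃ u ≤ t, V u j = L) ∧ ∀ x, e = .tx x → x ∈ S := by
      intro t i hi e he
      rw [hV, run_of_notMem hi] at he
      refine ⟨hext.due t i e he, ?_, ?_⟩
      · rintro τ j L rfl
        obtain ⟨u, hu, hL⟩ := hext.snap t i τ j L he
        by_cases hj : j ∈ Λ
        -- A snapshot of a simulated chain inside `ext` is empty by `hnil`, so it matches that
        -- chain's ledger at time `0`.
        · exact ⟨0, Nat.zero_le _, by rw [hV, run_zero hj, ← hL, hnil u j hj]⟩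
        · exact ⟨u, hu, by rw [hV, run_of_notMem hj, hL]⟩
      · rintro x rfl
        exact hext.tx t i x he
    intro t
    induction t with
    | zero =>
      intro t' ht' i e he
      obtain rfl : t' = 0 := by omega
      by_cases hi : i ∈ Λ
      · rw [hV, run_zero hi] at he
        simp at he
      · exact out 0 i hi e he
    | succ t ih =>
      intro t' ht' i e he
      rcases Nat.lt_or_ge t' (t + 1) with hlt | hge
      · exact ih t' (by omega) i e he
      obtain rfl : t' = t + 1 := by omega
      by_cases hi : i ∈ Λ
      swap
      · exact out _ i hi e he
      rw [hV, run_succ hi, ← hV] at he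
      rcases List.mem_append.1 he with he | he
      · obtain ⟨h₁, h₂, h₃⟩ := ih t le_rfl i e he
        refine ⟨h₁.mono (by omega), fun τ j L h => ?_, h₃⟩
        obtain ⟨u, hu, hL⟩ := h₂ τ j L h
        exact ⟨u, by omega, hL⟩
      have snap : ∀ t' ≤ t, ∀ i τ j L, Entry.snap τ j L ∈ V t' i → ∃ u ≤ t', V u j = L :=
        fun t' ht' i τ j L h => (ih t' ht' i _ h).2.1 τ j L rfl
      have hobs : ∀ w ∈ (observations env V t).map Prod.fst, ∃ u ≤ t, V u = w := by
        intro w hw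
        simp only [observations, List.map_map, List.mem_map, List.mem_range] at hw
        obtain ⟨u, hu, rfl⟩ := hw
        exact ⟨u, by omega, rfl⟩
      rcases mem_emitted.1 he with ⟨x, hx, rfl⟩ | ⟨v, hv⟩
      · refine ⟨trivial, by simp, ?_⟩
        rintro _ ⟨⟩
        exact henv t x hx
      · have hsend := P.write_sendable _ _ _ _ _ hv
        cases e with
        | tx x =>
          refine ⟨trivial, by simp, ?_⟩
          rintro _ ⟨⟩
          rcases hsend with ⟨j, L, hL, hm⟩ | ⟨o, ho, hx⟩
          · obtain ⟨u, hu, rfl⟩ := exists_of_holds snap hobs hL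
            exact (ih u hu j _ hm).2.2 x rfl
          · simp only [observations, List.mem_map, List.mem_range] at ho
            obtain ⟨u, hu, rfl⟩ := ho
            exact henv u x hx
        | note τ d => exact ⟨le_trans (le_of_eq hsend) (Nat.le_succ t), by simp, by simp⟩
        | snap τ j L =>
          refine ⟨le_trans (le_of_eq hsend.1) (Nat.le_succ t), ?_, by simp⟩
          rintro _ _ _ ⟨⟩
          obtain ⟨u, hu, h⟩ := exists_of_holds snap hobs hsend.2
          exact ⟨u, by omega, h⟩
  refine ⟨fun i t t' h => ?_, fun t i e he => (main t t le_rfl i e he).1,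
    fun t i τ j L h => (main t t le_rfl i _ h).2.1 τ j L rfl,
    fun t i x h => (main t t le_rfl i _ h).2.2 x rfl⟩
  by_cases hi : i ∈ Λ
  · induction h with
    | refl => exact List.prefix_rfl
    | step _ ih =>
      refine ih.trans ?_
      rw [hV, run_succ hi]
      exact List.prefix_append _ _
  · rw [hV, run_of_notMem hi, run_of_notMem hi]
    exact hext.mono i t t' h

/-! ## Executions with prescribed views -/

/-- An execution with two clients, that have the views `V (some b)`, and one honest validator per
chain, all of which have the views `V none`. -/
def prescribed (P : Overlay k Tx) (Δ : ℕ) (V : Option Bool → ℕ → View k Tx)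
    (hV : ∀ m, Lawful Set.univ (V m)) (env : ℕ → List Tx) : Execution P Δ where
  Client := Bool
  Validator := Fin k
  validator_finite := inferInstance
  home := id
  home_surjective := Function.surjective_id
  join _ := 0
  env := env
  view r := V (r.elim some fun _ => none)
  cert i t := {L | ∃ m, ∃ u ≤ t, V m u i = L}
  cert_mono := by
    rintro i t t' h L ⟨m, u, hu, hL⟩
    exact ⟨m, u, hu.trans h, hL⟩
  cert_due := by
    rintro i t L ⟨m, u, hu, rfl⟩ e he
    exact ((hV m).due u i e he).mono hu
  cert_snap := by
    rintro i t L ⟨m, u, hu, rfl⟩ τ j L' h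
    obtain ⟨u', hu', h⟩ := (hV m).snap u i τ j L' h
    exact ⟨m, u', hu'.trans hu, h⟩
  view_cert r t _ i := ⟨_, t, le_rfl, rfl⟩
  arrival _ t _ _ := t
  arrival_ge _ _ _ _ := le_rfl
  arrival_le _ _ _ _ := Nat.le_add_right _ _

section Prescribed

variable {P : Overlay k Tx} {Δ : ℕ} {V : Option Bool → ℕ → View k Tx}
  {hV : ∀ m, Lawful Set.univ (V m)} {env : ℕ → List Tx}

theorem prescribed_underlaySafe {i : Fin k} {U : ℕ → Ledger k Tx}
    (hU : ∀ t t', t ≤ t' → U t <+: U t') (h : ∀ m t, V m t i = [] ∨ V m t i = U t) :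
    (prescribed P Δ V hV env).UnderlaySafe i := by
  refine ⟨?_, fun r t t' _ htt' => (hV _).mono i t t' htt'⟩
  rintro - - - ⟨m, u, -, rfl⟩ - ⟨m', u', -, rfl⟩
  rcases h m u with h₁ | h₁
  · exact Or.inl (h₁ ▸ List.nil_prefix)
  rcases h m' u' with h₂ | h₂
  · exact Or.inr (h₂ ▸ List.nil_prefix)
  rw [h₁, h₂]
  exact (le_total u u').imp (hU _ _) (hU _ _)

/-- The simulated validators have the views of the actual ones, hence write the same entries. Inputs
of time `a` are recorded at `a + 1`, whence `1 ≤ T`. -/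
theorem prescribed_underlayLive {Λ : Set (Fin k)} {ext : ℕ → View k Tx} {T : ℕ} (hT : 1 ≤ T)
    (hrun : V none = run P Λ ext env) {i : Fin k} (hi : i ∈ Λ)
    (h : ∀ m t, V m t i = V none t i) : (prescribed P Δ V hV env).UnderlayLive T i := by
  intro a e he r t' _ ht'
  change e ∈ V _ t' i
  rw [h]
  refine ((hV none).mono i (a + 1) t' (by omega)).subset ?_
  rw [hrun, run_succ hi, ← hrun]
  refine List.mem_append_right _ (mem_emitted.2 ?_)
  rcases he with he | ⟨v, t, hw, hat⟩
  · exact Or.inl he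
  · cases (show t = a from hat)
    exact Or.inr ⟨v, hw⟩

end Prescribed

/-! ## The attack -/

section Attack

variable {P : Overlay k Tx}

/-- The history in which the chains in `A` record everything, the other chains are stuck, and there
are no transactions. -/
noncomputable def quiet (P : Overlay k Tx) (A : Set (Fin k)) : ℕ → View k Tx :=
  run P A (fun _ _ => []) fun _ => []

/-- The input of `x` at time `0`. -/
def single (x : Tx) (t : ℕ) : List Tx := if t = 0 then [x] else []

/-- The history in which the transaction `x` is input at time `0`, and the chains in `X` have the
same ledgers as in the history `quiet P A`. -/
noncomputable def faked (P : Overlay k Tx) (A X : Set (Fin k)) (x : Tx) : ℕ → View k Tx :=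
  run P Xᶜ (quiet P A) (single x)

theorem lawful_quiet (A : Set (Fin k)) (S : Set Tx) : Lawful S (quiet P A) :=
  lawful_run (lawful_nil S) (by simp) (by simp)

theorem quiet_of_notMem {A : Set (Fin k)} {i : Fin k} (hi : i ∉ A) (t : ℕ) :
    quiet P A t i = [] := run_of_notMem hi t

theorem faked_of_mem {A X : Set (Fin k)} {i : Fin k} (hi : i ∈ X) (x : Tx) (t : ℕ) :
    faked P A X x t i = quiet P A t i := run_of_notMem (by simpa using hi) t

theorem lawful_faked {A X : Set (Fin k)} (hA : A ⊆ X) (x : Tx) :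
    Lawful {x} (faked P A X x) := by
  refine lawful_run (lawful_quiet A _) (fun t i hi => quiet_of_notMem (fun h => hi (hA h)) t) ?_
  intro t y hy
  unfold single at hy
  split_ifs at hy
  · simpa using hy
  · simp at hy

/-- A client shown this history cannot exclude that the validators see it too. Then the chains
outside `X` are live, so `x` must be output, and no other transaction has been seen. -/
theorem output_faked {Δ T T' : ℕ} (hT : 1 ≤ T) {l : ℤ} (hlive : ∀ E : Execution P Δ,
      l ≤ ({i | E.UnderlayLive T i} : Set (Fin k)).ncard → E.OverlayLive T')
    {A X : Set (Fin k)} (hA : A ⊆ X) (hX : l ≤ (Xᶜ).ncard) (x : Tx) :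
    x ∈ P.output T' ((List.range' 0 (T' + 1 - 0)).map (faked P A X x)) ∧
      ∀ y ∈ P.output T' ((List.range' 0 (T' + 1 - 0)).map (faked P A X x)), y = x := by
  have hlaw := lawful_faked (P := P) hA x
  constructor
  · let E := prescribed P Δ (fun _ => faked P A X x) (fun _ => hlaw.superset (Set.subset_univ _))
      (single x)
    refine hlive E (hX.trans ?_) 0 x (by simp [E, prescribed, single]) true T'
      (by simp [E, prescribed]) (by simp)
    refine Int.ofNat_le.2 (Set.ncard_le_ncard fun i hi => ?_)
    exact prescribed_underlayLive hT rfl hi fun _ _ => rfl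
  · intro y hy
    refine hlaw.mem_of_seenTx (t := T') ?_ (P.output_seen _ _ y hy)
    intro w hw
    simp only [List.mem_map, List.mem_range'_1] at hw
    obtain ⟨u, hu, rfl⟩ := hw
    exact ⟨u, by omega, rfl⟩

theorem Achievable.attack [Nontrivial Tx] {Δ T : ℕ} (hT : 1 ≤ T) {l s b : ℤ}
    (h : Achievable Tx k Δ T l s b) {A X Y : Set (Fin k)} (hAX : A ⊆ X) (hAY : A ⊆ Y)
    (hX : l ≤ (Xᶜ).ncard) (hY : l ≤ (Yᶜ).ncard) : (X ∪ Y).ncard < s ∧ A.ncard < b := by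
  obtain ⟨P, T', hP⟩ := h
  obtain ⟨x, y, hxy⟩ := exists_pair_ne Tx
  obtain ⟨hx, hx'⟩ := output_faked hT (fun E => (hP E).2) hAX hX x
  obtain ⟨hy, hy'⟩ := output_faked hT (fun E => (hP E).2) hAY hY y
  let V : Option Bool → ℕ → View k Tx
    | none => quiet P A
    | some true => faked P A X x
    | some false => faked P A Y y
  have hV : ∀ m, Lawful Set.univ (V m) := by
    rintro (_ | _ | _)
    · exact lawful_quiet A _
    · exact (lawful_faked hAY y).superset (Set.subset_univ _)
    · exact (lawful_faked hAX x).superset (Set.subset_univ _)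
  let E := prescribed P Δ V hV fun _ => []
  have notSafe : ¬ E.OverlaySafe := by
    rintro ⟨hs, -⟩
    rcases hs true false T' T' (Nat.zero_le _) (Nat.zero_le _) with hp | hp
    · exact hxy (hy' x (hp.subset hx))
    · exact hxy (hx' y (hp.subset hy)).symm
  have safe : ∀ i ∈ X ∪ Y, E.UnderlaySafe i := by
    intro i hi
    by_cases hiA : i ∈ A
    · refine prescribed_underlaySafe (U := fun t => quiet P A t i)
        ((lawful_quiet A Set.univ).mono i) ?_
      rintro (_ | _ | _) t
      · exact Or.inr rfl
      · exact Or.inr (faked_of_mem (hAY hiA) y t)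
      · exact Or.inr (faked_of_mem (hAX hiA) x t)
    -- Outside `A` the quiet history is empty, so a chain of `X` can be nonempty only in the history
    -- faked for `Y`, and vice versa.
    · rcases hi with hi | hi
      · refine prescribed_underlaySafe (U := fun t => faked P A Y y t i)
          ((lawful_faked hAY y).mono i) ?_
        rintro (_ | _ | _) t
        · exact Or.inl (quiet_of_notMem hiA t)
        · exact Or.inr rfl
        · exact Or.inl ((faked_of_mem hi x t).trans (quiet_of_notMem hiA t))
      · refine prescribed_underlaySafe (U := fun t => faked P A X x t i)
          ((lawful_faked hAX x).mono i) ?_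
        rintro (_ | _ | _) t
        · exact Or.inl (quiet_of_notMem hiA t)
        · exact Or.inl ((faked_of_mem hi y t).trans (quiet_of_notMem hiA t))
        · exact Or.inr rfl
  have live : ∀ i ∈ A, E.UnderlayLive T i := by
    intro i hi
    refine prescribed_underlayLive hT rfl hi ?_
    rintro (_ | _ | _) t
    · rfl
    · exact faked_of_mem (hAY hi) y t
    · exact faked_of_mem (hAX hi) x t
  constructor
  · by_contra! hle
    refine notSafe ((hP E).1 (Or.inl (hle.trans (Int.ofNat_le.2 (Set.ncard_le_ncard ?_)))))
    exact safe
  · by_contra! hle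
    refine notSafe ((hP E).1 (Or.inr (hle.trans (Int.ofNat_le.2 (Set.ncard_le_ncard ?_)))))
    exact fun i hi => ⟨safe i (Or.inl (hAX hi)), live i hi⟩

theorem Achievable.bounds [Nontrivial Tx] {Δ T : ℕ} (hT : 1 ≤ T) {l s b : ℤ}
    (h : Achievable Tx k Δ T l s b) (hl : l ≤ k) (hs : s ≤ k) :
    2 * (k - l) + 1 ≤ s ∧ k - l + 1 ≤ b := by
  have compl_le : ∀ X : Finset (Fin k), (X.card : ℤ) ≤ k - l → l ≤ ((X : Set (Fin k))ᶜ).ncard := by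
    intro X hX
    have := Set.ncard_add_ncard_compl (X : Set (Fin k))
    rw [Set.ncard_coe_finset, Nat.card_fin] at this
    omega
  have hfirst : 2 * (k - l) + 1 ≤ s := by
    by_contra! hlt
    -- `Z` will be `X ∪ Y`. The cap covers `2 * (k - l) > k`, where `Z` is everything and `k < s`
    -- contradicts `hs`.
    obtain ⟨Z, -, hZ⟩ := Finset.exists_subset_card_eq (s := (Finset.univ : Finset (Fin k)))
      (n := min (2 * (k - l).toNat) k) (by simp)
    obtain ⟨X, hXZ, hX⟩ := Finset.exists_subset_card_eq (s := Z)
      (n := min (k - l).toNat Z.card) (by simp)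
    have hY := Finset.card_sdiff_add_card_eq_card hXZ
    have := (h.attack hT (A := ∅) (X := X) (Y := ↑(Z \ X)) (Set.empty_subset _) (Set.empty_subset _)
      (compl_le _ (by omega)) (compl_le _ (by omega))).1
    rw [← Finset.coe_union, Finset.union_sdiff_of_subset hXZ, Set.ncard_coe_finset] at this
    omega
  refine ⟨hfirst, ?_⟩
  -- That `k - l` does not exceed `k` follows from `hfirst` and `hs`.
  obtain ⟨A, -, hA⟩ := Finset.exists_subset_card_eq (s := (Finset.univ : Finset (Fin k)))
    (n := (k - l).toNat) (by simp; omega)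
  have := (h.attack hT (A := A) (X := A) (Y := A) subset_rfl subset_rfl
    (compl_le _ (by omega)) (compl_le _ (by omega))).2
  rw [Set.ncard_coe_finset] at this
  omega

end Attack

end Interchain

theorem theorem3 (Tx : Type) [Nontrivial Tx] (k : ℕ) (hk : 1 ≤ k) (Δ T : ℕ) (hT : 1 ≤ T)
    (l s b : ℤ) :
    (((k : ℤ) / 2 + 1 ≤ l ∧ l ≤ k ∧ 2 * (k - l) + 1 ≤ s ∧ k - l + 1 ≤ b) →
        Interchain.Achievable Tx k Δ T l s b) ∧
      (l ≤ k → s ≤ k →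
        (Interchain.Achievable Tx k Δ T l s b ↔
          ((k : ℤ) / 2 + 1 ≤ l ∧ l ≤ k ∧ 2 * (k - l) + 1 ≤ s ∧ k - l + 1 ≤ b))) := by
  have sufficient : (k : ℤ) / 2 + 1 ≤ l ∧ l ≤ k ∧ 2 * (k - l) + 1 ≤ s ∧ k - l + 1 ≤ b →
      Interchain.Achievable Tx k Δ T l s b :=
    fun h => Interchain.achievable_of_le (by omega) h.2.2.1 h.2.2.2
  refine ⟨sufficient, fun hl hs => ⟨fun h => ?_, sufficient⟩⟩
  obtain ⟨h₁, h₂⟩ := h.bounds hT hl hs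
  -- The majority bound on `l` follows from `2 * (k - l) + 1 ≤ s ≤ k`.
  exact ⟨by omega, hl, h₁, h₂⟩
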